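/- Let $\mathbb{H}$ be the quaternions and let $X$ be a Banach two-sided $\mathbb{H}$-module, that is, an $\mathbb{H}$-bimodule with $rx=xr$ for all $r\in\mathbb{R}$, $x\in X$, endowed with a complete norm satisfying $\|qx\|=\|xq\|=|q|\,\|x\|$ for all $q\in\mathbb{H}$, $x\in X$. Let $\mathcal{L}^r(X)$ be the space of bounded right linear operators on $X$ with the operator norm; for $\mathsf{B}\in\mathcal{L}^r(X)$ and $p\in\mathbb{H}$ let $\mathsf{B}p\in\mathcal{L}^r(X)$ be the operator $(\mathsf{B}p)(x):=\mathsf{B}(px)$. Let $D(\mathsf{A})$ be a right $\mathbb{H}$-submodule of $X$ and let $\mathsf{A}:D(\mathsf{A})\to X$ be a right linear operator with closed graph. For $q\in\mathbb{H}$ let $$\Delta_q(\mathsf{A}):=\mathsf{A}^2-2\,\mathrm{Re}(q)\,\mathsf{A}+|q|^2\,\mathsf{Id}:\ D(\mathsf{A}^2)\to X,\qquad D(\mathsf{A}^2):=\{x\in D(\mathsf{A}):\mathsf{A}x\in D(\mathsf{A})\},$$ let $\rho_S(\mathsf{A})$ be the set of all $q\in\mathbb{H}$ such that $\Delta_q(\mathsf{A})$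 is bijective and $\Delta_q(\mathsf{A})^{-1}\in\mathcal{L}^r(X)$, and for $q\in\rho_S(\mathsf{A})$ put $\mathsf{Q}_q(\mathsf{A}):=\Delta_q(\mathsf{A})^{-1}$ and $\mathsf{S}_q^{-1}(\mathsf{A}):=\mathsf{Q}_q(\mathsf{A})\,\overline{q}-\mathsf{A}\mathsf{Q}_q(\mathsf{A})$, which is an element of $\mathcal{L}^r(X)$. For $p,q\in\mathbb{H}$ put $\triangle_q(p):=p^2-2\,\mathrm{Re}(q)\,p+|q|^2$ and $\mathrm{u}(p,q):=\sqrt{|\triangle_q(p)|}$ (the Cassini pseudo-metric); let $\mathrm{U}(q_0,R):=\{p\in\mathbb{H}:\mathrm{u}(p,q_0)<R\}$, and call the topology of $\mathbb{H}$ induced by $\mathrm{u}$ the Cassini topology. For $q_0\in\mathbb{H}$ and $k\ge 0$ put $P_{q_0,2k}(q):=\triangle_{q_0}(q)^k$ and $P_{q_0,2k+1}(q):=(q-q_0)\triangle_{q_0}(q)^k$. The spherical derivative $\partial_S f$ of $f=P_{q_0,n}$ is $\partial_S f(q):=(f(q)-f(\overline{q}))(q-\overline{q})^{-1}$ for $q\in\mathbb{H}\setminus\mathbb{R}$,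 and $\partial_S f(q):=\frac{\partial f}{\partial r}(q)$, the derivative of $f$ in the direction of the real axis, for $q\in\mathbb{R}$. Assume that $\rho_S(\mathsf{A})\cap\mathbb{R}\neq\emptyset$. Let $q_0\in\rho_S(\mathsf{A})$, let $R:=\|\mathsf{Q}_{q_0}(\mathsf{A})\|^{-1/2}>0$ (with $R:=+\infty$ if $X=0$), and for $k\ge0$ put $\mathsf{B}_{2k}:=\mathsf{Q}_{q_0}(\mathsf{A})^k$ and $\mathsf{B}_{2k+1}:=\mathsf{Q}_{q_0}(\mathsf{A})^k\,\mathsf{S}_{q_0}^{-1}(\mathsf{A})$. Then $\mathrm{U}(q_0,R)\subset\rho_S(\mathsf{A})$ and, for every $q\in\mathrm{U}(q_0,R)$, the series below converges (unconditionally) in $\mathcal{L}^r(X)$ with sum $$\mathsf{Q}_q(\mathsf{A})=\sum_{n=0}^{\infty}(-1)^{n+1}\,\mathsf{B}_{n+1}\,\partial_S P_{q_0,n}(q).$$ Moreover, if $\rho_S(\mathsf{A})$ carries the relative topology induced by the Cassini topology of $\mathbb{H}$, then the mapping $\rho_S(\mathsf{A})\to\mathcal{L}^r(X)$, $q\mapsto\mathsf{Q}_q(\mathsf{A})$,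 is continuous. -/

import Mathlib

open scoped Quaternion ENNReal
open MulOpposite

set_option linter.unusedSectionVars false

noncomputable section

namespace SRes

/-! ### Quaternionic functions -/

/-- The function `△_q(p) = p² - 2 Re(q) p + |q|²` on the quaternions. -/
def tri (q p : ℍ[ℝ]) : ℍ[ℝ] :=
  p ^ 2 - 2 * (q.re : ℍ[ℝ]) * p + ((‖q‖ ^ 2 : ℝ) : ℍ[ℝ])

/-- The Cassini pseudo-metric `u(p, q) = √|△_q(p)|`. -/
def cassini (p q : ℍ[ℝ]) : ℝ := Real.sqrt ‖tri q p‖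

/-- The Cassini ball with centre `q₀` and radius `R`. The radius is allowed to be `∞`, in which case
the ball is all of `ℍ`. -/
def cassiniBall (q₀ : ℍ[ℝ]) (R : ℝ≥0∞) : Set ℍ[ℝ] :=
  {p | ENNReal.ofReal (cassini p q₀) < R}

/-- The Cassini topology of `ℍ`: a set is open iff it contains, with each of its points, a Cassini
ball of positive real radius around that point. -/
@[reducible] def cassiniTopology : TopologicalSpace ℍ[ℝ] where
  IsOpen V := ∀ q ∈ V, ∃ R : ℝ, 0 < R ∧ cassiniBall q (ENNReal.ofReal R) ⊆ V
  isOpen_univ := fun _ _ => ⟨1, one_pos, Set.subset_univ _⟩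
  isOpen_inter := by
    rintro V W hV hW q ⟨hqV, hqW⟩
    obtain ⟨R, hR, hRV⟩ := hV q hqV
    obtain ⟨T, hT, hTW⟩ := hW q hqW
    refine ⟨min R T, lt_min hR hT, fun p hp => ⟨hRV ?_, hTW ?_⟩⟩
    · exact lt_of_lt_of_le hp (ENNReal.ofReal_le_ofReal (min_le_left _ _))
    · exact lt_of_lt_of_le hp (ENNReal.ofReal_le_ofReal (min_le_right _ _))
  isOpen_sUnion := by
    rintro 𝒱 h𝒱 q ⟨V, hV, hq⟩
    obtain ⟨R, hR, hRV⟩ := h𝒱 V hV q hq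
    exact ⟨R, hR, hRV.trans (Set.subset_sUnion_of_mem hV)⟩

/-- The spherical "powers" `P_{q₀,2k}(q) = △_{q₀}(q)^k`, `P_{q₀,2k+1}(q) = (q - q₀) △_{q₀}(q)^k`. -/
def sphPow (q₀ : ℍ[ℝ]) (n : ℕ) (q : ℍ[ℝ]) : ℍ[ℝ] :=
  if Even n then tri q₀ q ^ (n / 2) else (q - q₀) * tri q₀ q ^ (n / 2)

open Classical in
/-- The spherical derivative: `(f(q) - f(q̄)) (q - q̄)⁻¹` off the real axis, and the derivative in the
direction of the real axis at real points. -/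
def sphDeriv (f : ℍ[ℝ] → ℍ[ℝ]) (q : ℍ[ℝ]) : ℍ[ℝ] :=
  if q ∈ Set.range (fun r : ℝ => (r : ℍ[ℝ])) then lineDeriv ℝ f q 1
  else (f q - f (star q)) * (q - star q)⁻¹

/-! ### Bounded right linear operators -/

section Operators

variable (X : Type*) [NormedAddCommGroup X] [NormedSpace ℝ X]
  [Module ℍ[ℝ] X] [Module ℍ[ℝ]ᵐᵒᵖ X] [SMulCommClass ℍ[ℝ] ℍ[ℝ]ᵐᵒᵖ X]
  [IsScalarTower ℝ ℍ[ℝ] X] [IsScalarTower ℝ ℍ[ℝ]ᵐᵒᵖ X]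
  [NormSMulClass ℍ[ℝ] X] [NormSMulClass ℍ[ℝ]ᵐᵒᵖ X]

/-- The bounded right linear operators on `X`, with the operator norm. The right action
`x q` of a quaternion is `op q • x`. -/
def Lr : Subalgebra ℝ (X →L[ℝ] X) where
  carrier := {B | ∀ (q : ℍ[ℝ]) (x : X), B (op q • x) = op q • B x}
  mul_mem' := by
    intro B C hB hC q x
    simp only [Set.mem_ofPred_eq] at hB hC
    simp [hB, hC]
  add_mem' := by
    intro B C hB hC q x
    simp only [Set.mem_ofPred_eq] at hB hC
    simp [hB, hC]
  algebraMap_mem' := by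
    intro r q x
    simp only [Algebra.algebraMap_eq_smul_one, smul_apply,
      one_apply_eq_self]
    exact smul_comm _ _ _

variable {X}

/-- Left multiplication `x ↦ p x` by a quaternion, as a bounded right linear operator. -/
def leftMul (p : ℍ[ℝ]) : Lr X :=
  ⟨LinearMap.mkContinuous
    { toFun := fun x => p • x
      map_add' := fun x y => smul_add p x y
      map_smul' := fun r x => smul_comm p r x } ‖p‖ (fun x => (norm_smul p x).le),
    fun q x => smul_comm p (op q) x⟩

/-- The product `B p` of a bounded right linear operator and a quaternion: `(B p) x = B (p x)`. -/
def mulQ (B : Lr X) (p : ℍ[ℝ]) : Lr X := B * leftMul p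

lemma mulQ_apply (B : Lr X) (p : ℍ[ℝ]) (x : X) :
    (mulQ B p : X →L[ℝ] X) x = (B : X →L[ℝ] X) (p • x) := rfl

/-! ### The spherical resolvent of an unbounded right linear operator -/

/-- The domain `D(A²) = {x ∈ D(A) : A x ∈ D(A)}`. -/
def domainSq (A : X →ₗ.[ℍ[ℝ]ᵐᵒᵖ] X) : Submodule ℍ[ℝ]ᵐᵒᵖ X :=
  (A.domain.comap A.toFun).map A.domain.subtype

lemma mem_domainSq {A : X →ₗ.[ℍ[ℝ]ᵐᵒᵖ] X} {x : X} :
    x ∈ domainSq A ↔ ∃ hx : x ∈ A.domain, A ⟨x, hx⟩ ∈ A.domain := by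
  simp [domainSq]

lemma mem_domain_of_mem_domainSq {A : X →ₗ.[ℍ[ℝ]ᵐᵒᵖ] X} {x : X} (hx : x ∈ domainSq A) :
    x ∈ A.domain := (mem_domainSq.1 hx).1

lemma apply_mem_domain_of_mem_domainSq {A : X →ₗ.[ℍ[ℝ]ᵐᵒᵖ] X} {x : X} (hx : x ∈ domainSq A) :
    A ⟨x, mem_domain_of_mem_domainSq hx⟩ ∈ A.domain := (mem_domainSq.1 hx).2

/-- The restriction of `A` to `D(A²)`, with values in `D(A)`. -/
def restrSq (A : X →ₗ.[ℍ[ℝ]ᵐᵒᵖ] X) : domainSq A →ₗ[ℍ[ℝ]ᵐᵒᵖ] A.domain :=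
  LinearMap.codRestrict A.domain
    (A.toFun ∘ₗ Submodule.inclusion (fun _ hx => mem_domain_of_mem_domainSq hx))
    (fun x => apply_mem_domain_of_mem_domainSq x.2)

/-- The operator `Δ_q(A) = A² - 2 Re(q) A + |q|² Id : D(A²) → X`. -/
def Delta (A : X →ₗ.[ℍ[ℝ]ᵐᵒᵖ] X) (q : ℍ[ℝ]) : domainSq A →ₗ[ℍ[ℝ]ᵐᵒᵖ] X :=
  A.toFun ∘ₗ restrSq A - (2 * q.re) • (A.domain.subtype ∘ₗ restrSq A)
    + (‖q‖ ^ 2) • (domainSq A).subtype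

lemma Delta_apply (A : X →ₗ.[ℍ[ℝ]ᵐᵒᵖ] X) (q : ℍ[ℝ]) (x : domainSq A) :
    Delta A q x =
      A ⟨A ⟨x, mem_domain_of_mem_domainSq x.2⟩, apply_mem_domain_of_mem_domainSq x.2⟩
        - (2 * q.re) • A ⟨x, mem_domain_of_mem_domainSq x.2⟩ + (‖q‖ ^ 2) • (x : X) := rfl

/-- The S-resolvent set: the quaternions `q` such that `Δ_q(A)` is bijective with inverse
in `Lr X`. -/
def resolventSet (A : X →ₗ.[ℍ[ℝ]ᵐᵒᵖ] X) : Set ℍ[ℝ] :=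
  {q | Function.Bijective (Delta A q) ∧
    ∃ B : Lr X, ∀ x : domainSq A, (B : X →L[ℝ] X) (Delta A q x) = x}

/-- The operator `Q_q(A) = Δ_q(A)⁻¹`. -/
def Q (A : X →ₗ.[ℍ[ℝ]ᵐᵒᵖ] X) (q : resolventSet A) : Lr X := q.2.2.choose

lemma Q_Delta (A : X →ₗ.[ℍ[ℝ]ᵐᵒᵖ] X) (q : resolventSet A) (x : domainSq A) :
    (Q A q : X →L[ℝ] X) (Delta A q x) = x := q.2.2.choose_spec x

lemma Q_mem (A : X →ₗ.[ℍ[ℝ]ᵐᵒᵖ] X) (q : resolventSet A) (y : X) :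
    (Q A q : X →L[ℝ] X) y ∈ domainSq A := by
  obtain ⟨x, rfl⟩ := q.2.1.2 y
  rw [Q_Delta]
  exact x.2

lemma Delta_Q (A : X →ₗ.[ℍ[ℝ]ᵐᵒᵖ] X) (q : resolventSet A) (y : X) :
    Delta A q ⟨(Q A q : X →L[ℝ] X) y, Q_mem A q y⟩ = y := by
  obtain ⟨x, rfl⟩ := q.2.1.2 y
  congr 1
  exact Subtype.ext (Q_Delta A q x)

/-- The everywhere defined operator `A Q_q(A)`, as a real linear map. -/
def AQLin (A : X →ₗ.[ℍ[ℝ]ᵐᵒᵖ] X) (q : resolventSet A) : X →ₗ[ℝ] X where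
  toFun x := A ⟨(Q A q : X →L[ℝ] X) x, mem_domain_of_mem_domainSq (Q_mem A q x)⟩
  map_add' x y := by
    rw [← A.map_add]
    congr 1
    exact Subtype.ext (map_add _ x y)
  map_smul' r x := by
    refine Eq.trans ?_ (A.toFun.map_smul_of_tower r _)
    refine congrArg A ?_
    exact Subtype.ext (map_smul _ r x)

lemma AQLin_continuous [CompleteSpace X] (A : X →ₗ.[ℍ[ℝ]ᵐᵒᵖ] X)
    (hA : IsClosed (A.graph : Set (X × X))) (q : resolventSet A) : Continuous (AQLin A q) := by
  apply LinearMap.continuous_of_isClosed_graph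
  have h : ((AQLin A q).graph : Set (X × X)) =
      (fun z : X × X => ((Q A q : X →L[ℝ] X) z.1, z.2)) ⁻¹' (A.graph : Set (X × X)) := by
    ext ⟨x, y⟩
    simp only [SetLike.mem_coe, LinearMap.mem_graph_iff, Set.mem_preimage, LinearPMap.mem_graph_iff]
    constructor
    · rintro rfl
      exact ⟨⟨_, mem_domain_of_mem_domainSq (Q_mem A q x)⟩, rfl, rfl⟩
    · rintro ⟨⟨z, hz⟩, h1, h2⟩
      simp only at h1
      subst h1
      exact h2.symm
  rw [h]
  exact hA.preimage (by fun_prop)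

/-- The operator `A Q_q(A)`; it is bounded by the closed graph theorem. -/
def AQ [CompleteSpace X] (A : X →ₗ.[ℍ[ℝ]ᵐᵒᵖ] X) (hA : IsClosed (A.graph : Set (X × X)))
    (q : resolventSet A) : Lr X :=
  ⟨⟨AQLin A q, AQLin_continuous A hA q⟩, by
    intro p x
    change A _ = op p • A _
    rw [← A.map_smul]
    refine congrArg A ?_
    exact Subtype.ext ((Q A q).2 p x)⟩

lemma AQ_apply [CompleteSpace X] (A : X →ₗ.[ℍ[ℝ]ᵐᵒᵖ] X)
    (hA : IsClosed (A.graph : Set (X × X))) (q : resolventSet A) (x : X) :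
    (AQ A hA q : X →L[ℝ] X) x =
      A ⟨(Q A q : X →L[ℝ] X) x, mem_domain_of_mem_domainSq (Q_mem A q x)⟩ := rfl

/-- The S-resolvent operator `S_q⁻¹(A) = Q_q(A) q̄ - A Q_q(A)`. -/
def S [CompleteSpace X] (A : X →ₗ.[ℍ[ℝ]ᵐᵒᵖ] X) (hA : IsClosed (A.graph : Set (X × X)))
    (q : resolventSet A) : Lr X :=
  mulQ (Q A q) (star (q : ℍ[ℝ])) - AQ A hA q

/-- The coefficients `B_{2k} = Q_{q₀}(A)^k` and `B_{2k+1} = Q_{q₀}(A)^k S_{q₀}⁻¹(A)`. -/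
def B [CompleteSpace X] (A : X →ₗ.[ℍ[ℝ]ᵐᵒᵖ] X) (hA : IsClosed (A.graph : Set (X × X)))
    (q₀ : resolventSet A) (n : ℕ) : Lr X :=
  if Even n then Q A q₀ ^ (n / 2) else Q A q₀ ^ (n / 2) * S A hA q₀

/-- The radius `‖Q_{q₀}(A)‖^{-1/2}` as an extended real; it is `∞` only if `X = 0`. -/
def radius (A : X →ₗ.[ℍ[ℝ]ᵐᵒᵖ] X) (q₀ : resolventSet A) : ℝ≥0∞ :=
  ENNReal.ofReal ‖Q A q₀‖ ^ (-(1 / 2) : ℝ)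

end Operators

end SRes

end

/-! Write `P = Q_{q₀}(A)`, `R = A P`, `x = Re q`, `x₀ = Re q₀`. Since `A² P = 1 + 2 x₀ R - |q₀|² P`,
one has `Δ_q(A) P = 1 - T` with `T = 2(x - x₀) R - (|q|² - |q₀|²) P`. So if `1 - T` has a bounded
two-sided inverse `V`, then `q ∈ ρ_S(A)` and `Q_q(A) = P V`. Only `P`, `R` and real scalars enter
`T`, so everything takes place among commuting operators.

The norm of `T` need not be below 1 on the Cassini ball, so no Neumann series in `T` is available.
Instead, put `t = △_{q₀}(q) = 2(x - x₀) q - (|q|² - |q₀|²)`. The relation `q² = 2 x q - |q|²` gives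
`t^k = c_k + d_k q` with real `c_k`, `d_k` obeying a linear recursion. With `F_k = (c_k + d_k A)
P^k` and `V_k = F_k + 2(x - x₀) d_k P^k`, the recursion yields `(1 - T) V_k = F_k - F_{k+1}`, and
the sum telescopes to `F_0 = 1` (`exists_inverse_of_recursion`). As `d_k` grows at most like `k
|t|^(k-1)`, all series converge when `|t| ‖P‖ < 1`, which is the Cassini ball.

The spherical derivatives of `P_{q₀,2k}` and `P_{q₀,2k+1}` are `d_k` and `c_k + d_k (2x - q₀)`;
adding the terms of index `2k` and `2k+1` cancels the quaternion `q₀` and leaves `P V_k`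
(`hasSum_Q`).

For continuity, `T` is small when `u(q, q₀)` is small, because the Cassini distance controls `Re q`
and `|Im q|`, hence `|q|²`; then `Q_q(A) (1 - T) = P` bounds `Q_q(A) - P`. -/

noncomputable section

namespace SRes

/-! ### The coefficients of the powers of `△_{q₀}(q)` -/

/-- The real numbers `(c, d)` with `△_{q₀}(q) ^ k = c + d q`. -/
def triCoeff (q₀ q : ℍ[ℝ]) : ℕ → ℝ × ℝ
  | 0 => (1, 0)
  | k + 1 =>
    (-(‖q‖ ^ 2 - ‖q₀‖ ^ 2) * (triCoeff q₀ q k).1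
        - 2 * (q.re - q₀.re) * ‖q‖ ^ 2 * (triCoeff q₀ q k).2,
      2 * (q.re - q₀.re) * (triCoeff q₀ q k).1
        + (4 * (q.re - q₀.re) * q.re - (‖q‖ ^ 2 - ‖q₀‖ ^ 2)) * (triCoeff q₀ q k).2)

lemma norm_sq_eq_sum (q : ℍ[ℝ]) :
    ‖q‖ ^ 2 = q.re ^ 2 + q.imI ^ 2 + q.imJ ^ 2 + q.imK ^ 2 := by
  rw [sq, ← Quaternion.normSq_eq_norm_mul_self, Quaternion.normSq_def']

lemma tri_eq (q₀ q : ℍ[ℝ]) :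
    tri q₀ q = (2 * (q.re - q₀.re)) • q - ((‖q‖ ^ 2 - ‖q₀‖ ^ 2 : ℝ) : ℍ[ℝ]) := by
  have h := norm_sq_eq_sum q
  have h2 : (2 : ℍ[ℝ]) = ((2 : ℝ) : ℍ[ℝ]) := rfl
  rw [tri, h2]
  generalize ‖q‖ ^ 2 = N at h ⊢
  generalize ‖q₀‖ ^ 2 = N₀
  subst h
  ext <;> simp only [sq] <;> simp <;> ring1

lemma tri_pow_eq (q₀ q : ℍ[ℝ]) (k : ℕ) :
    tri q₀ q ^ k = ((triCoeff q₀ q k).1 : ℍ[ℝ]) + (triCoeff q₀ q k).2 • q := by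
  induction k with
  | zero => simp [triCoeff]
  | succ k ih =>
    rw [pow_succ, ih, tri_eq, triCoeff]
    have h := norm_sq_eq_sum q
    generalize (triCoeff q₀ q k).1 = c
    generalize (triCoeff q₀ q k).2 = d
    generalize ‖q‖ ^ 2 = N at h ⊢
    generalize ‖q₀‖ ^ 2 = N₀
    ext <;> simp only [Quaternion.re_mul, Quaternion.imI_mul, Quaternion.imJ_mul,
      Quaternion.imK_mul, Quaternion.re_add, Quaternion.imI_add, Quaternion.imJ_add,
      Quaternion.imK_add, Quaternion.re_sub, Quaternion.imI_sub, Quaternion.imJ_sub,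
      Quaternion.imK_sub, Quaternion.re_smul, Quaternion.imI_smul, Quaternion.imJ_smul,
      Quaternion.imK_smul, Quaternion.re_coe, Quaternion.imI_coe, Quaternion.imJ_coe,
      Quaternion.imK_coe, smul_eq_mul, h] <;> ring1

/-- A Leibniz rule for the coefficient of `q` in `t * t^k`, with `t = tri q₀ q`. It never divides by
`q - q̄`, so it gives estimates valid up to the real axis and also serves as the product rule at
real points. -/
lemma triCoeff_succ_snd (q₀ q : ℍ[ℝ]) (k : ℕ) :
    ((triCoeff q₀ q (k + 1)).2 : ℍ[ℝ]) =
      (2 * (q.re - q₀.re)) • star (tri q₀ q ^ k)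
        + tri q₀ q * ((triCoeff q₀ q k).2 : ℍ[ℝ]) := by
  rw [tri_pow_eq, tri_eq, triCoeff]
  ext <;> simp <;> ring

lemma tri_star (q₀ q : ℍ[ℝ]) : tri q₀ (star q) = star (tri q₀ q) := by
  simp only [tri_eq]
  ext <;> simp

lemma abs_triCoeff_succ_snd_le (q₀ q : ℍ[ℝ]) (k : ℕ) :
    |(triCoeff q₀ q (k + 1)).2| ≤ |2 * (q.re - q₀.re)| * ((k + 1) * ‖tri q₀ q‖ ^ k) := by
  have key : ∀ k, |(triCoeff q₀ q (k + 1)).2| ≤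
      |2 * (q.re - q₀.re)| * ‖tri q₀ q‖ ^ k + ‖tri q₀ q‖ * |(triCoeff q₀ q k).2| := by
    intro k
    have h := congrArg norm (triCoeff_succ_snd q₀ q k)
    rw [Quaternion.norm_coe, Real.norm_eq_abs] at h
    rw [h]
    refine (norm_add_le _ _).trans (le_of_eq ?_)
    rw [norm_smul, norm_star, norm_pow, Real.norm_eq_abs, norm_mul, Quaternion.norm_coe,
      Real.norm_eq_abs]
  induction k with
  | zero => simp [triCoeff]
  | succ k ih =>
    refine (key (k + 1)).trans ?_
    calc _ ≤ |2 * (q.re - q₀.re)| * ‖tri q₀ q‖ ^ (k + 1)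
          + ‖tri q₀ q‖ * (|2 * (q.re - q₀.re)| * ((k + 1) * ‖tri q₀ q‖ ^ k)) := by gcongr
      _ = _ := by push_cast; ring

lemma abs_triCoeff_fst_le (q₀ q : ℍ[ℝ]) (k : ℕ) :
    |(triCoeff q₀ q k).1| ≤ ‖tri q₀ q‖ ^ k + |(triCoeff q₀ q k).2| * ‖q‖ := by
  have h : ((triCoeff q₀ q k).1 : ℍ[ℝ]) = tri q₀ q ^ k - (triCoeff q₀ q k).2 • q := by
    rw [tri_pow_eq]; abel
  have h' := congrArg norm h
  rw [Quaternion.norm_coe, Real.norm_eq_abs] at h'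
  rw [h']
  refine (norm_sub_le _ _).trans (le_of_eq ?_)
  rw [norm_pow, norm_smul, Real.norm_eq_abs]

section Summability

variable {q₀ q : ℍ[ℝ]} {ρ : ℝ}

lemma summable_triCoeff_succ_snd (hρ : 0 ≤ ρ) (h : ‖tri q₀ q‖ * ρ < 1) :
    Summable fun k => |(triCoeff q₀ q (k + 1)).2| * ρ ^ k := by
  have hr : ‖‖tri q₀ q‖ * ρ‖ < 1 := by
    rwa [Real.norm_of_nonneg (by positivity)]
  have h1 : Summable fun k : ℕ => ((k : ℝ) + 1) * (‖tri q₀ q‖ * ρ) ^ k := by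
    have h2 := summable_pow_mul_geometric_of_norm_lt_one 1 hr
    have h3 := summable_geometric_of_norm_lt_one hr
    refine (h2.add h3).congr fun k => ?_
    ring
  refine Summable.of_nonneg_of_le (fun k => by positivity) (fun k => ?_)
    (h1.mul_left |2 * (q.re - q₀.re)|)
  calc _ ≤ |2 * (q.re - q₀.re)| * ((k + 1) * ‖tri q₀ q‖ ^ k) * ρ ^ k := by
        gcongr; exact abs_triCoeff_succ_snd_le q₀ q k
    _ = _ := by rw [mul_pow]; ring

lemma summable_triCoeff_snd (hρ : 0 ≤ ρ) (h : ‖tri q₀ q‖ * ρ < 1) :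
    Summable fun k => |(triCoeff q₀ q k).2| * ρ ^ k := by
  rw [← summable_nat_add_iff 1]
  refine ((summable_triCoeff_succ_snd hρ h).mul_right ρ).congr fun k => ?_
  ring

lemma summable_triCoeff_fst (hρ : 0 ≤ ρ) (h : ‖tri q₀ q‖ * ρ < 1) :
    Summable fun k => |(triCoeff q₀ q k).1| * ρ ^ k := by
  have h3 := summable_geometric_of_lt_one (by positivity) h
  refine Summable.of_nonneg_of_le (fun k => by positivity) (fun k => ?_)
    (h3.add ((summable_triCoeff_snd hρ h).mul_right ‖q‖))
  calc _ ≤ (‖tri q₀ q‖ ^ k + |(triCoeff q₀ q k).2| * ‖q‖) * ρ ^ k := by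
        gcongr; exact abs_triCoeff_fst_le q₀ q k
    _ = _ := by rw [mul_pow]; ring

end Summability

/-! ### Spherical derivatives of the spherical powers -/

lemma sphPow_even (q₀ : ℍ[ℝ]) (k : ℕ) : sphPow q₀ (2 * k) = fun q => tri q₀ q ^ k := by
  funext q
  simp [sphPow]

lemma sphPow_odd (q₀ : ℍ[ℝ]) (k : ℕ) :
    sphPow q₀ (2 * k + 1) = fun q => (q - q₀) * tri q₀ q ^ k := by
  funext q
  have : (2 * k + 1) / 2 = k := by omega
  simp [sphPow, this]

lemma hasDerivAt_tri_line (q₀ : ℍ[ℝ]) (r : ℝ) :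
    HasDerivAt (fun s : ℝ => tri q₀ ((r : ℍ[ℝ]) + s • 1)) ((2 * (r - q₀.re) : ℝ) : ℍ[ℝ]) 0 := by
  have h : (fun s : ℝ => tri q₀ ((r : ℍ[ℝ]) + s • 1)) = fun s : ℝ =>
      ((r + s) ^ 2 - 2 * q₀.re * (r + s) + ‖q₀‖ ^ 2) • (1 : ℍ[ℝ]) := by
    funext s
    have h2 : (2 : ℍ[ℝ]) = ((2 : ℝ) : ℍ[ℝ]) := rfl
    rw [tri, h2]
    ext <;> simp [sq]
  rw [h]
  have h1 : HasDerivAt (fun s : ℝ => (r + s) ^ 2 - 2 * q₀.re * (r + s) + ‖q₀‖ ^ 2)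
      (2 * (r - q₀.re)) 0 := by
    have hs : HasDerivAt (fun s : ℝ => r + s) 1 0 := (hasDerivAt_id (0 : ℝ)).const_add r
    refine (((hs.pow 2).sub (hs.const_mul (2 * q₀.re))).add_const (‖q₀‖ ^ 2)).congr_deriv ?_
    simp
    ring
  refine (h1.smul_const (1 : ℍ[ℝ])).congr_deriv ?_
  ext <;> simp

lemma hasDerivAt_tri_pow_line (q₀ : ℍ[ℝ]) (r : ℝ) (k : ℕ) :
    HasDerivAt (fun s : ℝ => tri q₀ ((r : ℍ[ℝ]) + s • 1) ^ k)
      ((triCoeff q₀ r k).2 : ℍ[ℝ]) 0 := by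
  induction k with
  | zero => simpa [triCoeff] using hasDerivAt_const (0 : ℝ) (1 : ℍ[ℝ])
  | succ k ih =>
    simp only [pow_succ']
    refine ((hasDerivAt_tri_line q₀ r).mul ih).congr_deriv ?_
    rw [triCoeff_succ_snd, star_pow, ← tri_star]
    rw [Quaternion.coe_mul_eq_smul]
    simp

lemma sub_star_ne_zero {q : ℍ[ℝ]} (hq : q ∉ Set.range (fun r : ℝ => (r : ℍ[ℝ]))) :
    q - star q ≠ 0 := by
  intro h
  rw [sub_eq_zero, eq_comm, Quaternion.star_eq_self] at h
  exact hq ⟨q.re, h.symm⟩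

lemma sphDeriv_sphPow_even (q₀ q : ℍ[ℝ]) (k : ℕ) :
    sphDeriv (sphPow q₀ (2 * k)) q = ((triCoeff q₀ q k).2 : ℍ[ℝ]) := by
  rw [sphPow_even, sphDeriv]
  split_ifs with hq
  · obtain ⟨r, rfl⟩ := hq
    exact (hasDerivAt_tri_pow_line q₀ r k).deriv
  · rw [eq_comm, eq_mul_inv_iff_mul_eq₀ (sub_star_ne_zero hq)]
    simp only [tri_star, ← star_pow]
    rw [tri_pow_eq]
    ext <;> simp <;> ring

/-- Expand `(q - q₀)(c + d q)` and use `q² = 2 Re(q) q - |q|²`: the coefficient standing to the left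
of `q` is `c + d (2 Re q - q₀)`. -/
lemma sphDeriv_sphPow_odd (q₀ q : ℍ[ℝ]) (k : ℕ) :
    sphDeriv (sphPow q₀ (2 * k + 1)) q = ((triCoeff q₀ q k).1 : ℍ[ℝ])
      + (triCoeff q₀ q k).2 • ((2 * q.re : ℝ) - q₀ : ℍ[ℝ]) := by
  rw [sphPow_odd, sphDeriv]
  split_ifs with hq
  · obtain ⟨r, rfl⟩ := hq
    have h1 : HasDerivAt (fun s : ℝ => (r : ℍ[ℝ]) + s • 1 - q₀) 1 0 := by
      simpa using (((hasDerivAt_id (0 : ℝ)).smul_const (1 : ℍ[ℝ])).const_add (r : ℍ[ℝ])).sub_const q₀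
    refine ((h1.mul (hasDerivAt_tri_pow_line q₀ r k)).deriv).trans ?_
    simp only [zero_smul, add_zero, tri_pow_eq]
    ext <;> simp <;> ring
  · rw [eq_comm, eq_mul_inv_iff_mul_eq₀ (sub_star_ne_zero hq)]
    simp only [tri_star, ← star_pow]
    rw [tri_pow_eq]
    ext <;> simp <;> ring

/-! ### Comparison with the Cassini pseudo-metric -/

/-- With `y = |Im q|`, `y₀ = |Im q₀|` and `D = (x - x₀)² + (y - y₀)²`, the exact formula is
`|△_{q₀}(q)|² = D (D + 4 y y₀)`, which is at least `D²`. -/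
lemma re_sub_sq_add_le_norm_tri (q₀ q : ℍ[ℝ]) :
    (q.re - q₀.re) ^ 2 + (‖q.im‖ - ‖q₀.im‖) ^ 2 ≤ ‖tri q₀ q‖ := by
  have hy := norm_sq_eq_sum q.im
  have hy₀ := norm_sq_eq_sum q₀.im
  simp only [Quaternion.re_im, Quaternion.imI_im, Quaternion.imJ_im, Quaternion.imK_im] at hy hy₀
  have ht := norm_sq_eq_sum (tri q₀ q)
  have h : ‖tri q₀ q‖ ^ 2 = ((q.re - q₀.re) ^ 2 + (‖q.im‖ - ‖q₀.im‖) ^ 2) ^ 2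
      + 4 * (‖q.im‖ * ‖q₀.im‖) * ((q.re - q₀.re) ^ 2 + (‖q.im‖ - ‖q₀.im‖) ^ 2) := by
    have e : ((q.re - q₀.re) ^ 2 + (‖q.im‖ - ‖q₀.im‖) ^ 2) ^ 2
      + 4 * (‖q.im‖ * ‖q₀.im‖) * ((q.re - q₀.re) ^ 2 + (‖q.im‖ - ‖q₀.im‖) ^ 2)
      = (‖q.im‖ ^ 2 - ‖q₀.im‖ ^ 2 - (q.re - q₀.re) ^ 2) ^ 2
        + 4 * (q.re - q₀.re) ^ 2 * ‖q.im‖ ^ 2 := by ring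
    have hq := norm_sq_eq_sum q
    have hq₀ := norm_sq_eq_sum q₀
    rw [e, ht, hy, hy₀, tri_eq]
    generalize ‖q‖ ^ 2 = N at hq ⊢
    generalize ‖q₀‖ ^ 2 = N₀ at hq₀ ⊢
    simp only [Quaternion.re_sub, Quaternion.imI_sub, Quaternion.imJ_sub,
      Quaternion.imK_sub, Quaternion.re_smul, Quaternion.imI_smul, Quaternion.imJ_smul,
      Quaternion.imK_smul, Quaternion.re_coe, Quaternion.imI_coe, Quaternion.imJ_coe,
      Quaternion.imK_coe, smul_eq_mul, hq, hq₀]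
    ring
  refine le_of_sq_le_sq ?_ (norm_nonneg _)
  rw [h]
  have : 0 ≤ 4 * (‖q.im‖ * ‖q₀.im‖) * ((q.re - q₀.re) ^ 2 + (‖q.im‖ - ‖q₀.im‖) ^ 2) := by
    positivity
  linarith

lemma norm_sq_eq_re_im (q : ℍ[ℝ]) : ‖q‖ ^ 2 = q.re ^ 2 + ‖q.im‖ ^ 2 := by
  rw [norm_sq_eq_sum, norm_sq_eq_sum]
  simp
  ring

lemma abs_re_sub_le_cassini (q₀ q : ℍ[ℝ]) : |q.re - q₀.re| ≤ cassini q q₀ := by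
  refine Real.abs_le_sqrt ((le_add_of_nonneg_right ?_).trans (re_sub_sq_add_le_norm_tri q₀ q))
  positivity

lemma abs_norm_im_sub_le_cassini (q₀ q : ℍ[ℝ]) : |‖q.im‖ - ‖q₀.im‖| ≤ cassini q q₀ := by
  refine Real.abs_le_sqrt ((le_add_of_nonneg_left ?_).trans (re_sub_sq_add_le_norm_tri q₀ q))
  positivity

lemma abs_norm_sq_sub_le_cassini (q₀ q : ℍ[ℝ]) :
    |‖q‖ ^ 2 - ‖q₀‖ ^ 2| ≤
      cassini q q₀ * (2 * cassini q q₀ + 2 * |q₀.re| + 2 * ‖q₀.im‖) := by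
  have aux : ∀ a b u : ℝ, |a - b| ≤ u → |a ^ 2 - b ^ 2| ≤ u * (u + 2 * |b|) := by
    intro a b u h
    have h1 : a ^ 2 - b ^ 2 = (a - b) * ((a - b) + 2 * b) := by ring
    have hu : 0 ≤ u := (abs_nonneg _).trans h
    rw [h1, abs_mul]
    gcongr
    refine (abs_add_le _ _).trans ?_
    rw [abs_mul, abs_two]
    gcongr
  have h1 := aux _ _ _ (abs_re_sub_le_cassini q₀ q)
  have h2 := aux _ _ _ (abs_norm_im_sub_le_cassini q₀ q)
  rw [abs_norm] at h2
  rw [norm_sq_eq_re_im q, norm_sq_eq_re_im q₀]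
  calc _ = |(q.re ^ 2 - q₀.re ^ 2) + (‖q.im‖ ^ 2 - ‖q₀.im‖ ^ 2)| := by congr 1; ring
    _ ≤ _ := (abs_add_le _ _).trans (add_le_add h1 h2)
    _ = _ := by ring

/-! ### A telescoping series in a Banach algebra -/

section BanachAlgebra

variable {E : Type*} [NormedRing E] [NormedAlgebra ℝ E] [CompleteSpace E]

/-- If `R = A P` and `P` is the inverse of `A² - 2 x₀ A + n₀`, then the inverse of
`1 - (2 (x - x₀) R - (n - n₀) P)` is a series in `P` and `R`, whose coefficients obey a linear
recursion. -/
lemma exists_inverse_of_recursion {P R : E} {x x₀ n n₀ : ℝ} {c d : ℕ → ℝ}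
    (hPR : P * R = R * P)
    (hRR : R * R = P + (2 * x₀) • (R * P) - n₀ • (P * P))
    (hc₀ : c 0 = 1) (hd₀ : d 0 = 0)
    (hc : ∀ k, c (k + 1) = -(n - n₀) * c k - 2 * (x - x₀) * n * d k)
    (hd : ∀ k, d (k + 1) = 2 * (x - x₀) * c k + (4 * (x - x₀) * x - (n - n₀)) * d k)
    (sc : Summable fun k => c k • P ^ k) (sd : Summable fun k => d k • P ^ k)
    (sd' : Summable fun k => d (k + 1) • (R * P ^ k)) :
    ∃ V : E,
      (1 - ((2 * (x - x₀)) • R - (n - n₀) • P)) * V = 1 ∧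
      V * (1 - ((2 * (x - x₀)) • R - (n - n₀) • P)) = 1 ∧
      HasSum (fun k => (c k + 2 * (x - x₀) * d k) • P ^ (k + 1) + d k • (R * P ^ k)) (P * V) := by
  set T : E := (2 * (x - x₀)) • R - (n - n₀) • P with hT
  -- `rp k` plays the role of `A P^k`. At `k = 0` this would be the unbounded `A`; the value 0 is
  -- harmless because `d 0 = 0`.
  let rp : ℕ → E := fun k => Nat.casesOn k 0 fun k => R * P ^ k
  let F : ℕ → E := fun k => c k • P ^ k + d k • rp k
  let V : ℕ → E := fun k => F k + (2 * (x - x₀)) • (d k • P ^ k)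
  have hPrp : ∀ k, d k • (P * rp k) = d k • (R * P ^ k) := by
    rintro (_ | k)
    · simp [hd₀]
    · change d (k + 1) • (P * (R * P ^ k)) = _
      rw [← mul_assoc, hPR, mul_assoc, ← pow_succ']
  have srp : Summable fun k => d k • rp k := (summable_nat_add_iff 1).1 sd'
  have sF : Summable F := sc.add srp
  have sV : Summable V := sF.add (sd.const_smul _)
  have hTP : T * P = P * T := by
    simp only [hT, sub_mul, mul_sub, smul_mul_assoc, mul_smul_comm, hPR]
  have hTR : T * R = R * T := by
    simp only [hT, sub_mul, mul_sub, smul_mul_assoc, mul_smul_comm, hPR]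
  have hTPk : ∀ k, T * P ^ k = P ^ k * T := fun k => Commute.pow_right (show Commute T P from hTP) k
  have hTrp : ∀ k, T * rp k = rp k * T := by
    rintro (_ | k)
    · change T * 0 = 0 * T
      simp
    · change T * (R * P ^ k) = R * P ^ k * T
      rw [← mul_assoc, hTR, mul_assoc, hTPk, mul_assoc]
  have hTV : ∀ k, T * V k = V k * T := by
    intro k
    simp only [V, F, mul_add, add_mul, mul_smul_comm, smul_mul_assoc, hTPk, hTrp]
  have key : ∀ k, T * V k = V k - (F k - F (k + 1)) := by
    intro k
    suffices h : T * V k = F (k + 1) + (2 * (x - x₀)) • (d k • P ^ k) by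
      rw [h]; simp only [V]; abel
    cases k with
    | zero =>
      simp only [V, F, rp, hc, hd, hc₀, hd₀, hT]
      simp only [Nat.rec_zero, pow_zero, pow_one, zero_add, mul_one, mul_zero, zero_smul, smul_zero,
        add_zero, one_smul, sub_zero]
      module
    | succ k =>
      have h1 : V (k + 1) = (c (k + 1) • P + d (k + 1) • R
          + (2 * (x - x₀)) • (d (k + 1) • P)) * P ^ k := by
        simp only [V, F, rp, add_mul, smul_mul_assoc, ← pow_succ']
      have h2 : F (k + 1 + 1) + (2 * (x - x₀)) • (d (k + 1) • P ^ (k + 1)) =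
          (c (k + 1 + 1) • (P * P) + d (k + 1 + 1) • (R * P)
          + (2 * (x - x₀)) • (d (k + 1) • P)) * P ^ k := by
        simp only [F, rp, add_mul, smul_mul_assoc, ← pow_succ', mul_assoc]
      rw [h1, h2, ← mul_assoc]
      congr 1
      rw [hc (k + 1), hd (k + 1)]
      generalize c (k + 1) = c'
      generalize d (k + 1) = d'
      simp only [hT, sub_mul, mul_add, smul_mul_assoc, mul_smul_comm, hPR, hRR]
      module
  -- Telescoping: the sum is `F 0 = 1`.
  have hF : HasSum (fun k => F k - F (k + 1)) 1 := by
    have h1 : HasSum (fun k => F (k + 1)) ((∑' k, F k) - F 0) := by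
      simpa using (hasSum_nat_add_iff' 1).2 sF.hasSum
    have h2 := sF.hasSum.sub h1
    have h3 : F 0 = 1 := by simp [F, hc₀, hd₀]
    rwa [h3, sub_sub_cancel] at h2
  have hV := sV.hasSum
  have hTVs : T * ∑' k, V k = (∑' k, V k) - 1 :=
    (hV.mul_left T).unique (by simpa only [key] using hV.sub hF)
  have hVTs : (∑' k, V k) * T = (∑' k, V k) - 1 :=
    (hV.mul_right T).unique (by simpa only [← hTV, key] using hV.sub hF)
  refine ⟨∑' k, V k, ?_, ?_, ?_⟩
  · rw [sub_mul, hTVs]; simp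
  · rw [mul_sub, hVTs]; simp
  · refine (hV.mul_left P).congr_fun ?_
    intro k
    simp only [V, F, mul_add, mul_smul_comm, hPrp, ← pow_succ']
    module

end BanachAlgebra

/-! ### Bounded right linear operators -/

section Operators

variable {X : Type*} [NormedAddCommGroup X] [NormedSpace ℝ X]
  [Module ℍ[ℝ] X] [Module ℍ[ℝ]ᵐᵒᵖ X] [SMulCommClass ℍ[ℝ] ℍ[ℝ]ᵐᵒᵖ X]
  [IsScalarTower ℝ ℍ[ℝ] X] [IsScalarTower ℝ ℍ[ℝ]ᵐᵒᵖ X]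
  [NormSMulClass ℍ[ℝ] X] [NormSMulClass ℍ[ℝ]ᵐᵒᵖ X]

lemma continuous_op_smul (q : ℍ[ℝ]) : Continuous fun x : X => op q • x :=
  AddMonoidHomClass.continuous_of_bound (DistribSMul.toAddMonoidHom X (op q)) ‖op q‖
    fun x => (norm_smul (op q) x).le

/-- Right linearity is a family of pointwise closed conditions. This makes `Lr X` complete, so that
absolutely convergent series in it converge. -/
lemma isClosed_Lr : IsClosed (Lr X : Set (X →L[ℝ] X)) := by
  have h : (Lr X : Set (X →L[ℝ] X)) =
      ⋂ (q : ℍ[ℝ]) (x : X), {B | B (op q • x) = op q • B x} := by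
    ext B
    simp [Lr]
  rw [h]
  refine isClosed_iInter fun q => isClosed_iInter fun x => isClosed_eq ?_ ?_
  · fun_prop
  · exact (continuous_op_smul q).comp (by fun_prop)

instance completeSpace_Lr [CompleteSpace X] : CompleteSpace (Lr X) :=
  isClosed_Lr.completeSpace_coe

lemma Lr_ext {B C : Lr X} (h : ∀ x, (B : X →L[ℝ] X) x = (C : X →L[ℝ] X) x) : B = C :=
  Subtype.ext (ContinuousLinearMap.ext h)

lemma norm_one_Lr_le : ‖(1 : Lr X)‖ ≤ 1 := ContinuousLinearMap.norm_id_le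

/-- The exponent 0 needs care: the identity has norm 0 when `X = 0`. -/
lemma norm_pow_Lr_le (P : Lr X) (k : ℕ) : ‖P ^ k‖ ≤ ‖P‖ ^ k := by
  cases k with
  | zero => simpa using norm_one_Lr_le
  | succ k => exact norm_pow_le' P k.succ_pos

lemma leftMul_add (p q : ℍ[ℝ]) : (leftMul (p + q) : Lr X) = leftMul p + leftMul q :=
  Lr_ext fun x => add_smul p q x

lemma leftMul_coe (r : ℝ) : (leftMul (r : ℍ[ℝ]) : Lr X) = r • 1 := by
  refine Lr_ext fun x => ?_
  change (r : ℍ[ℝ]) • x = r • x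
  rw [← mul_one (r : ℍ[ℝ]), Quaternion.coe_mul_eq_smul, smul_assoc, one_smul]

lemma leftMul_smul (r : ℝ) (p : ℍ[ℝ]) : (leftMul (r • p) : Lr X) = r • leftMul p :=
  Lr_ext fun x => smul_assoc r p x

/-! ### Algebraic relations between `Q_q(A)` and `A Q_q(A)` -/

variable {A : X →ₗ.[ℍ[ℝ]ᵐᵒᵖ] X}

lemma map_real_smul (r : ℝ) (x : A.domain) : A (r • x) = r • A x :=
  A.toFun.map_smul_of_tower r x

lemma apply_congr {x y : X} (hx : x ∈ A.domain) (h : x = y) : A ⟨x, hx⟩ = A ⟨y, h ▸ hx⟩ := by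
  subst h; rfl

lemma exists_Q_apply_eq (q : resolventSet A) (x : domainSq A) :
    ∃ y, (Q A q : X →L[ℝ] X) y = x := ⟨_, Q_Delta A q x⟩

lemma AQ_mem_domain [CompleteSpace X] (hA : IsClosed (A.graph : Set (X × X)))
    (q : resolventSet A) (x : X) : (AQ A hA q : X →L[ℝ] X) x ∈ A.domain :=
  apply_mem_domain_of_mem_domainSq (Q_mem A q x)

/-- The identity `A² Q_q(A) = Id + 2 Re(q) A Q_q(A) - |q|² Q_q(A)`. -/
lemma apply_AQ [CompleteSpace X] (hA : IsClosed (A.graph : Set (X × X)))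
    (q : resolventSet A) (x : X) :
    A ⟨(AQ A hA q : X →L[ℝ] X) x, AQ_mem_domain hA q x⟩ =
      x + (2 * (q : ℍ[ℝ]).re) • (AQ A hA q : X →L[ℝ] X) x
        - (‖(q : ℍ[ℝ])‖ ^ 2) • (Q A q : X →L[ℝ] X) x := by
  have h := Delta_Q A q x
  rw [Delta_apply] at h
  refine Eq.trans ?_ (congrArg (fun v => v + (2 * (q : ℍ[ℝ]).re) • (AQ A hA q : X →L[ℝ] X) x
    - (‖(q : ℍ[ℝ])‖ ^ 2) • (Q A q : X →L[ℝ] X) x) h)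
  simp only [AQ_apply]
  abel

lemma Delta_Q_eq [CompleteSpace X] (hA : IsClosed (A.graph : Set (X × X)))
    (q₀ : resolventSet A) (q : ℍ[ℝ]) (y : X) :
    Delta A q ⟨(Q A q₀ : X →L[ℝ] X) y, Q_mem A q₀ y⟩ =
      ((1 - ((2 * (q.re - (q₀ : ℍ[ℝ]).re)) • AQ A hA q₀
        - (‖q‖ ^ 2 - ‖(q₀ : ℍ[ℝ])‖ ^ 2) • Q A q₀) : Lr X) : X →L[ℝ] X) y := by
  have h := apply_AQ hA q₀ y
  rw [Delta_apply]
  refine (congrArg (fun z => z - (2 * q.re) • (AQ A hA q₀ : X →L[ℝ] X) y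
    + (‖q‖ ^ 2) • (Q A q₀ : X →L[ℝ] X) y) h).trans ?_
  simp
  module

/-- `Q_q(A) A x = A Q_q(A) x` for `x` in the domain of `A`. -/
lemma Q_apply_eq_AQ [CompleteSpace X] (hA : IsClosed (A.graph : Set (X × X)))
    (q : resolventSet A) (x : A.domain) :
    (Q A q : X →L[ℝ] X) (A x) = (AQ A hA q : X →L[ℝ] X) x := by
  have h := apply_AQ hA q x
  have hQ : (Q A q : X →L[ℝ] X) x ∈ A.domain := mem_domain_of_mem_domainSq (Q_mem A q x)
  let y : A.domain := ⟨(Q A q : X →L[ℝ] X) x, hQ⟩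
  let z : A.domain := ⟨(AQ A hA q : X →L[ℝ] X) x, AQ_mem_domain hA q x⟩
  -- As `x` itself lies in `D(A)`, this puts `A z` in `D(A)`. So `z = A Q x` is in `D(A²)`, where
  -- `Δ_q(A) z = A x`, and `Q_q(A)` inverts `Δ_q(A)`.
  have hw : A z = ((x + (2 * (q : ℍ[ℝ]).re) • z - (‖(q : ℍ[ℝ])‖ ^ 2) • y : A.domain) : X) := h
  have hz : A z ∈ A.domain := hw ▸ Subtype.property _
  have hmem : (z : X) ∈ domainSq A := mem_domainSq.2 ⟨z.2, hz⟩
  refine Eq.trans ?_ (Q_Delta A q ⟨z, hmem⟩)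
  rw [Delta_apply]
  congr 1
  have h2 : A ⟨A z, hz⟩ = A x + (2 * (q : ℍ[ℝ]).re) • A z - (‖(q : ℍ[ℝ])‖ ^ 2) • A y := by
    rw [apply_congr hz hw]
    rw [Subtype.coe_eta, A.map_sub, A.map_add, map_real_smul, map_real_smul]
  refine Eq.symm ((congrArg (fun v => v - (2 * (q : ℍ[ℝ]).re) • A z
    + (‖(q : ℍ[ℝ])‖ ^ 2) • A y) h2).trans ?_)
  abel

lemma Q_mul_AQ [CompleteSpace X] (hA : IsClosed (A.graph : Set (X × X))) (q : resolventSet A) :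
    Q A q * AQ A hA q = AQ A hA q * Q A q :=
  Lr_ext fun x => Q_apply_eq_AQ hA q
    ⟨(Q A q : X →L[ℝ] X) x, mem_domain_of_mem_domainSq (Q_mem A q x)⟩

lemma AQ_mul_AQ [CompleteSpace X] (hA : IsClosed (A.graph : Set (X × X))) (q : resolventSet A) :
    AQ A hA q * AQ A hA q = Q A q + (2 * (q : ℍ[ℝ]).re) • (AQ A hA q * Q A q)
      - (‖(q : ℍ[ℝ])‖ ^ 2) • (Q A q * Q A q) := by
  refine Lr_ext fun x => ?_
  -- Move one factor `A` inside `Q`, so that the formula for `A² Q` applies.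
  refine (Q_apply_eq_AQ hA q ⟨_, AQ_mem_domain hA q x⟩).symm.trans ?_
  rw [apply_AQ, map_sub, map_add, map_smul, map_smul, ← Q_mul_AQ]
  rfl

/-! ### The expansion of `Q_q(A)` around `q₀` -/

lemma radius_pos (q₀ : resolventSet A) : 0 < radius A q₀ :=
  pos_iff_ne_zero.2 fun h => by
    rcases ENNReal.rpow_eq_zero_iff.1 h with ⟨-, h⟩ | ⟨h, -⟩
    · norm_num at h
    · exact ENNReal.ofReal_ne_top h

lemma norm_tri_mul_lt_one (q₀ : resolventSet A) {q : ℍ[ℝ]}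
    (hq : q ∈ cassiniBall q₀ (radius A q₀)) : ‖tri q₀ q‖ * ‖Q A q₀‖ < 1 := by
  -- The case `‖Q‖ = 0` is that of infinite radius.
  rcases (norm_nonneg (Q A q₀)).eq_or_lt with h0 | h0
  · simp [← h0]
  have h : ENNReal.ofReal (cassini q q₀) < radius A q₀ := hq
  rw [radius, ENNReal.ofReal_rpow_of_pos h0,
    ENNReal.ofReal_lt_ofReal_iff (Real.rpow_pos_of_pos h0 _), cassini,
    Real.rpow_neg h0.le, ← Real.sqrt_eq_rpow, ← Real.sqrt_inv,
    Real.sqrt_lt_sqrt_iff (norm_nonneg _)] at h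
  calc _ < ‖Q A q₀‖⁻¹ * ‖Q A q₀‖ := by gcongr
    _ = 1 := inv_mul_cancel₀ h0.ne'

variable [CompleteSpace X] (hA : IsClosed (A.graph : Set (X × X)))

/-- The operator `2 (Re q - Re q₀) A Q_{q₀}(A) - (|q|² - |q₀|²) Q_{q₀}(A)`, that is
`Id - Δ_q(A) Q_{q₀}(A)`. -/
def perturbation (q₀ : resolventSet A) (q : ℍ[ℝ]) : Lr X :=
  (2 * (q.re - (q₀ : ℍ[ℝ]).re)) • AQ A hA q₀ - (‖q‖ ^ 2 - ‖(q₀ : ℍ[ℝ])‖ ^ 2) • Q A q₀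

lemma summable_smul_of_abs {a : ℕ → ℝ} {P : Lr X} (ha : Summable fun k => |a k| * ‖P‖ ^ k)
    (C D : Lr X) : Summable fun k => a k • (C * P ^ k * D) := by
  refine Summable.of_norm_bounded ((ha.mul_left ‖C‖).mul_right ‖D‖) fun k => ?_
  rw [norm_smul, Real.norm_eq_abs]
  calc _ ≤ |a k| * (‖C‖ * ‖P‖ ^ k * ‖D‖) := by
        gcongr
        refine (norm_mul_le _ _).trans (mul_le_mul_of_nonneg_right ?_ (norm_nonneg _))
        refine (norm_mul_le _ _).trans ?_
        exact mul_le_mul_of_nonneg_left (norm_pow_Lr_le P k) (norm_nonneg _)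
    _ = _ := by ring

lemma exists_inverse_one_sub_perturbation (q₀ : resolventSet A) {q : ℍ[ℝ]}
    (hq : ‖tri q₀ q‖ * ‖Q A q₀‖ < 1) :
    ∃ V : Lr X, (1 - perturbation hA q₀ q) * V = 1 ∧ V * (1 - perturbation hA q₀ q) = 1 ∧
      HasSum (fun k => ((triCoeff q₀ q k).1
          + 2 * (q.re - (q₀ : ℍ[ℝ]).re) * (triCoeff q₀ q k).2) • Q A q₀ ^ (k + 1)
          + (triCoeff q₀ q k).2 • (AQ A hA q₀ * Q A q₀ ^ k)) (Q A q₀ * V) := by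
  refine exists_inverse_of_recursion (Q_mul_AQ hA q₀) (AQ_mul_AQ hA q₀) rfl rfl
    (fun _ => rfl) (fun _ => rfl) ?_ ?_ ?_
  · simpa using summable_smul_of_abs (summable_triCoeff_fst (norm_nonneg _) hq) 1 1
  · simpa using summable_smul_of_abs (summable_triCoeff_snd (norm_nonneg _) hq) 1 1
  · simpa using summable_smul_of_abs (summable_triCoeff_succ_snd (norm_nonneg _) hq) (AQ A hA q₀) 1

/-- `Q_{q₀}(A)` maps `X` onto `D(A²)` and `Δ_q(A) Q_{q₀}(A) = 1 - T`, so `Q_{q₀}(A) V` inverts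
`Δ_q(A)`: the left inverse of `1 - T` gives injectivity, the right inverse surjectivity. -/
lemma mem_resolventSet_of_inverse (q₀ : resolventSet A) {q : ℍ[ℝ]} {V : Lr X}
    (h1 : (1 - perturbation hA q₀ q) * V = 1) (h2 : V * (1 - perturbation hA q₀ q) = 1) :
    q ∈ resolventSet A := by
  have h1' : ∀ y, ((1 - perturbation hA q₀ q : Lr X) : X →L[ℝ] X) ((V : X →L[ℝ] X) y) = y :=
    fun y => congrArg (fun B : Lr X => (B : X →L[ℝ] X) y) h1
  have h2' : ∀ y, (V : X →L[ℝ] X) (((1 - perturbation hA q₀ q : Lr X) : X →L[ℝ] X) y) = y :=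
    fun y => congrArg (fun B : Lr X => (B : X →L[ℝ] X) y) h2
  have hB : ∀ x : domainSq A, ((Q A q₀ * V : Lr X) : X →L[ℝ] X) (Delta A q x) = x := by
    rintro ⟨x, hx⟩
    obtain ⟨y, rfl⟩ := exists_Q_apply_eq q₀ ⟨x, hx⟩
    rw [Delta_Q_eq hA]
    exact congrArg (Q A q₀ : X →L[ℝ] X) (h2' y)
  refine ⟨⟨fun x y hxy => Subtype.ext ?_, fun y => ?_⟩, Q A q₀ * V, hB⟩
  · rw [← hB x, ← hB y, hxy]
  · exact ⟨_, (Delta_Q_eq hA q₀ q ((V : X →L[ℝ] X) y)).trans (h1' y)⟩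

lemma Q_mul_one_sub_perturbation (q₀ q : resolventSet A) :
    Q A q * (1 - perturbation hA q₀ q) = Q A q₀ := by
  refine Lr_ext fun y => ?_
  have h := Q_Delta A q ⟨(Q A q₀ : X →L[ℝ] X) y, Q_mem A q₀ y⟩
  rwa [Delta_Q_eq hA] at h

lemma B_odd (q₀ : resolventSet A) (k : ℕ) :
    B A hA q₀ (2 * k + 1) = Q A q₀ ^ k * S A hA q₀ := by
  have : (2 * k + 1) / 2 = k := by omega
  simp [B, this]

lemma B_even (q₀ : resolventSet A) (k : ℕ) : B A hA q₀ (2 * k) = Q A q₀ ^ k := by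
  simp [B]

lemma leftMul_star (q : ℍ[ℝ]) :
    (leftMul (star q) : Lr X) = (2 * q.re) • 1 - leftMul q := by
  have h : star q = ((2 * q.re : ℝ) : ℍ[ℝ]) + (-1 : ℝ) • q := by
    ext <;> simp
    ring
  rw [h, leftMul_add, leftMul_smul, leftMul_coe]
  module

lemma even_term_eq (q₀ : resolventSet A) (q : ℍ[ℝ]) (k : ℕ) :
    (-1) ^ (2 * k + 1) *
      mulQ (B A hA q₀ (2 * k + 1)) (sphDeriv (sphPow q₀ (2 * k)) q) =
    -((triCoeff q₀ q k).2 • (1 * Q A q₀ ^ k * S A hA q₀)) := by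
  have h : (-1 : Lr X) ^ (2 * k + 1) = -1 := Odd.neg_one_pow (α := Lr X) ⟨k, rfl⟩
  rw [sphDeriv_sphPow_even, B_odd, mulQ, leftMul_coe, h]
  have h' : ∀ C : Lr X, -1 * C = -C := fun C => neg_one_mul C
  simp [h']

lemma odd_term_eq (q₀ : resolventSet A) (q : ℍ[ℝ]) (k : ℕ) :
    (-1) ^ (2 * k + 1 + 1) *
      mulQ (B A hA q₀ (2 * k + 1 + 1)) (sphDeriv (sphPow q₀ (2 * k + 1)) q) =
    (triCoeff q₀ q k).1 • (Q A q₀ * Q A q₀ ^ k * 1) +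
      (triCoeff q₀ q k).2 • (Q A q₀ * Q A q₀ ^ k * leftMul ((2 * q.re : ℝ) - q₀ : ℍ[ℝ])) := by
  have e : 2 * k + 1 + 1 = 2 * (k + 1) := by ring
  have h : (-1 : Lr X) ^ (2 * (k + 1)) = 1 := Even.neg_one_pow (α := Lr X) (even_two_mul _)
  rw [sphDeriv_sphPow_odd, e, B_even, mulQ, leftMul_add, leftMul_smul, leftMul_coe,
    h, ← pow_succ', one_mul, mul_add, mul_smul_comm, mul_smul_comm]

lemma hasSum_Q (q₀ q : resolventSet A) (hq : ‖tri q₀ q‖ * ‖Q A q₀‖ < 1) :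
    HasSum (fun n : ℕ => (-1) ^ (n + 1) *
      mulQ (B A hA q₀ (n + 1)) (sphDeriv (sphPow q₀ n) q)) (Q A q) := by
  obtain ⟨V, h1, -, hV⟩ := exists_inverse_one_sub_perturbation hA q₀ hq
  have hQ : Q A q = Q A q₀ * V := by
    rw [← Q_mul_one_sub_perturbation hA q₀ q, mul_assoc, h1, mul_one]
  have sd := summable_triCoeff_snd (norm_nonneg _) hq
  have se := (summable_smul_of_abs sd 1 (S A hA q₀)).neg
  have so := (summable_smul_of_abs (summable_triCoeff_fst (norm_nonneg _) hq) (Q A q₀) 1).add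
    (summable_smul_of_abs sd (Q A q₀) (leftMul ((2 * (q : ℍ[ℝ]).re : ℝ) - q₀ : ℍ[ℝ])))
  have hsum := se.hasSum.add so.hasSum
  -- The even and odd subseries converge absolutely on their own; their termwise sum is identified
  -- with the series for `P V`.
  rw [hQ, hV.unique (hsum.congr_fun fun k => ?_)]
  · refine HasSum.even_add_odd ?_ ?_
    · simpa only [even_term_eq] using se.hasSum
    · simpa only [odd_term_eq] using so.hasSum
  · have e : ((2 * (q : ℍ[ℝ]).re : ℝ) - q₀ : ℍ[ℝ]) =
        ((2 * (q : ℍ[ℝ]).re : ℝ) : ℍ[ℝ]) + (-1 : ℝ) • (q₀ : ℍ[ℝ]) := by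
      rw [neg_one_smul, sub_eq_add_neg]
    -- Writing `q̄₀ = 2 Re q₀ - q₀` inside `S`, the two contributions of left multiplication by `q₀`
    -- cancel.
    have hcomm : AQ A hA q₀ * Q A q₀ ^ k = Q A q₀ ^ k * AQ A hA q₀ :=
      Commute.pow_right (show Commute _ _ from (Q_mul_AQ hA q₀).symm) k
    rw [e, leftMul_add, leftMul_coe, leftMul_smul, S, mulQ, leftMul_star, hcomm, ← pow_succ']
    simp only [one_mul, mul_add, mul_sub, mul_smul_comm, mul_one, ← mul_assoc, ← pow_succ]
    module

/-! ### Continuity in the Cassini topology -/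

lemma norm_perturbation_le (q₀ : resolventSet A) (q : ℍ[ℝ]) :
    ‖perturbation hA q₀ q‖ ≤ cassini q q₀ * (2 * ‖AQ A hA q₀‖
      + (2 * cassini q q₀ + 2 * |(q₀ : ℍ[ℝ]).re| + 2 * ‖(q₀ : ℍ[ℝ]).im‖) * ‖Q A q₀‖) := by
  refine (norm_sub_le _ _).trans ?_
  rw [norm_smul, norm_smul, Real.norm_eq_abs, Real.norm_eq_abs, abs_mul, abs_two]
  have h1 := mul_le_mul_of_nonneg_right (abs_re_sub_le_cassini q₀ q) (norm_nonneg (AQ A hA q₀))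
  have h2 := mul_le_mul_of_nonneg_right (abs_norm_sq_sub_le_cassini q₀ q) (norm_nonneg (Q A q₀))
  calc _ ≤ 2 * (cassini q q₀ * ‖AQ A hA q₀‖) + cassini q q₀ *
        (2 * cassini q q₀ + 2 * |(q₀ : ℍ[ℝ]).re| + 2 * ‖(q₀ : ℍ[ℝ]).im‖) * ‖Q A q₀‖ := by
        refine add_le_add ?_ h2
        rw [mul_assoc]
        exact mul_le_mul_of_nonneg_left h1 zero_le_two
    _ = _ := by ring

lemma norm_Q_sub_Q_le (q₀ q : resolventSet A) :
    ‖Q A q - Q A q₀‖ * (1 - ‖perturbation hA q₀ q‖) ≤ ‖Q A q₀‖ * ‖perturbation hA q₀ q‖ := by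
  have h : Q A q - Q A q₀ = (Q A q - Q A q₀) * perturbation hA q₀ q
      + Q A q₀ * perturbation hA q₀ q := by
    have h0 := Q_mul_one_sub_perturbation hA q₀ q
    rw [mul_sub, mul_one, sub_eq_iff_eq_add] at h0
    rw [sub_mul, sub_add_cancel, sub_eq_iff_eq_add', ← h0]
  have h2 : ‖Q A q - Q A q₀‖ ≤ ‖Q A q - Q A q₀‖ * ‖perturbation hA q₀ q‖
      + ‖Q A q₀‖ * ‖perturbation hA q₀ q‖ := by
    conv_lhs => rw [h]
    exact (norm_add_le _ _).trans (add_le_add (norm_mul_le _ _) (norm_mul_le _ _))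
  linarith

lemma cassini_nonneg (p q : ℍ[ℝ]) : 0 ≤ cassini p q := Real.sqrt_nonneg _

lemma exists_cassini_norm_Q_sub_Q_lt (hA : IsClosed (A.graph : Set (X × X)))
    (q₀ : resolventSet A) {ε : ℝ} (hε : 0 < ε) :
    ∃ δ > 0, ∀ q : resolventSet A, cassini q q₀ < δ → ‖Q A q - Q A q₀‖ < ε := by
  let g : ℝ → ℝ := fun u => u * (2 * ‖AQ A hA q₀‖
      + (2 * u + 2 * |(q₀ : ℍ[ℝ]).re| + 2 * ‖(q₀ : ℍ[ℝ]).im‖) * ‖Q A q₀‖)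
  have hg : ContinuousAt g 0 := by
    have : Continuous g := by fun_prop
    exact this.continuousAt
  -- If `‖T‖ < η` and the difference had norm at least `ε`, then `ε ≤ (ε + ‖Q‖) ‖T‖ < ε`; the extra
  -- 1 makes `η < 1`.
  set η : ℝ := ε / (ε + ‖Q A q₀‖ + 1) with hη
  have hη0 : 0 < η := by positivity
  obtain ⟨δ, hδ, h⟩ := Metric.continuousAt_iff.1 hg η hη0
  refine ⟨δ, hδ, fun q hq => ?_⟩
  have hu := cassini_nonneg q q₀
  have h1 := h (x := cassini q q₀) (by rwa [Real.dist_eq, sub_zero, abs_of_nonneg hu])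
  have h2 : ‖perturbation hA q₀ q‖ < η := by
    refine (norm_perturbation_le hA q₀ q).trans_lt ?_
    rw [Real.dist_eq] at h1
    simpa [g] using (le_abs_self _).trans_lt h1
  have h3 := norm_Q_sub_Q_le hA q₀ q
  have hpos : 0 < ε + ‖Q A q₀‖ + 1 := by positivity
  have h4 : η * (ε + ‖Q A q₀‖ + 1) = ε := by rw [hη]; field_simp
  have h5 : η < 1 := by
    rw [hη, div_lt_one hpos]
    linarith [norm_nonneg (Q A q₀)]
  by_contra! hc
  have h6 : ε * (1 - ‖perturbation hA q₀ q‖) ≤ ‖Q A q₀‖ * ‖perturbation hA q₀ q‖ :=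
    (mul_le_mul_of_nonneg_right hc (by linarith)).trans h3
  nlinarith [norm_nonneg (Q A q₀)]

lemma cassiniBall_subset_resolventSet (hA : IsClosed (A.graph : Set (X × X)))
    (q₀ : resolventSet A) : cassiniBall q₀ (radius A q₀) ⊆ resolventSet A := by
  intro q hq
  obtain ⟨V, h1, h2, -⟩ :=
    exists_inverse_one_sub_perturbation hA q₀ (norm_tri_mul_lt_one q₀ hq)
  exact mem_resolventSet_of_inverse hA q₀ h1 h2

lemma exists_ofReal_le_radius (q₀ : resolventSet A) :
    ∃ r : ℝ, 0 < r ∧ ENNReal.ofReal r ≤ radius A q₀ := by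
  obtain ⟨r, hr, hr'⟩ := ENNReal.lt_iff_exists_nnreal_btwn.1 (radius_pos q₀)
  refine ⟨r, by exact_mod_cast hr, ?_⟩
  rw [ENNReal.ofReal_coe_nnreal]
  exact hr'.le

lemma continuous_Q_cassini (hA : IsClosed (A.graph : Set (X × X))) :
    @Continuous (resolventSet A) (Lr X)
      (TopologicalSpace.induced Subtype.val cassiniTopology) inferInstance
      (fun q => Q A q) := by
  refine @Continuous.mk _ _ (TopologicalSpace.induced Subtype.val cassiniTopology) _ _
    fun O hO => ?_
  refine (@isOpen_induced_iff _ _ cassiniTopology _ _).2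
    ⟨Subtype.val '' ((fun q : resolventSet A => Q A q) ⁻¹' O), ?_,
    Set.preimage_image_eq _ Subtype.val_injective⟩
  rintro _ ⟨q₀, hq₀, rfl⟩
  obtain ⟨ε, hε, hεO⟩ := Metric.isOpen_iff.1 hO _ hq₀
  obtain ⟨δ, hδ, hδε⟩ := exists_cassini_norm_Q_sub_Q_lt hA q₀ hε
  -- The ball is shrunk to lie in `ρ_S(A)`, so the image of the preimage of `O` is already Cassini
  -- open in the whole of `ℍ`.
  obtain ⟨r, hr, hr'⟩ := exists_ofReal_le_radius q₀
  refine ⟨min δ r, lt_min hδ hr, fun q hq => ?_⟩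
  have hq' : ENNReal.ofReal (cassini q q₀) < ENNReal.ofReal (min δ r) := hq
  have hmem : q ∈ resolventSet A := by
    refine cassiniBall_subset_resolventSet hA q₀ (lt_of_lt_of_le hq' ?_)
    exact (ENNReal.ofReal_le_ofReal (min_le_right _ _)).trans hr'
  refine ⟨⟨q, hmem⟩, hεO ?_, rfl⟩
  rw [Metric.mem_ball, dist_eq_norm]
  refine hδε ⟨q, hmem⟩ (lt_of_lt_of_le ?_ (min_le_left δ r))
  exact (ENNReal.ofReal_lt_ofReal_iff (lt_min hδ hr)).1 hq'

end Operators

end SRes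

end

theorem mainTheorem4 {X : Type*} [NormedAddCommGroup X] [NormedSpace ℝ X] [CompleteSpace X]
    [Module ℍ[ℝ] X] [Module ℍ[ℝ]ᵐᵒᵖ X] [SMulCommClass ℍ[ℝ] ℍ[ℝ]ᵐᵒᵖ X]
    [IsScalarTower ℝ ℍ[ℝ] X] [IsScalarTower ℝ ℍ[ℝ]ᵐᵒᵖ X]
    [NormSMulClass ℍ[ℝ] X] [NormSMulClass ℍ[ℝ]ᵐᵒᵖ X]
    (A : X →ₗ.[ℍ[ℝ]ᵐᵒᵖ] X) (hA : IsClosed (A.graph : Set (X × X)))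
    (hρ : (SRes.resolventSet A ∩ Set.range (fun r : ℝ => (r : ℍ[ℝ]))).Nonempty) :
    (∀ q₀ : SRes.resolventSet A,
      0 < SRes.radius A q₀ ∧
      SRes.cassiniBall q₀ (SRes.radius A q₀) ⊆ SRes.resolventSet A ∧
      ∀ q : SRes.resolventSet A, (q : ℍ[ℝ]) ∈ SRes.cassiniBall q₀ (SRes.radius A q₀) →
        HasSum
          (fun n : ℕ => (-1) ^ (n + 1) *
            SRes.mulQ (SRes.B A hA q₀ (n + 1)) (SRes.sphDeriv (SRes.sphPow q₀ n) q))
          (SRes.Q A q)) ∧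
    @Continuous (SRes.resolventSet A) (SRes.Lr X)
      (TopologicalSpace.induced Subtype.val SRes.cassiniTopology) inferInstance
      (fun q => SRes.Q A q) := by
  refine ⟨fun q₀ => ⟨SRes.radius_pos q₀, SRes.cassiniBall_subset_resolventSet hA q₀,
    fun q hq => SRes.hasSum_Q hA q₀ q (SRes.norm_tri_mul_lt_one q₀ hq)⟩,
    SRes.continuous_Q_cassini hA⟩
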